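/- Let $d\ge 0$ be an integer and let $r>0$. For $a\in\mathbb{R}^d$ and $b\in\mathbb{R}$ consider the hash function $$h_{a,b}(x)=\Big\lfloor \frac{\langle a,x\rangle+b}{r}\Big\rfloor ,\qquad x\in\mathbb{R}^d .$$ Let the L2 (2-stable) LSH kernel with bucket width $r$ be its collision probability $$\mathcal{K}(x,y)=\Pr\big[h_{a,b}(x)=h_{a,b}(y)\big],\qquad x,y\in\mathbb{R}^d ,$$ where $a$ has independent standard normal coordinates, $b$ is uniformly distributed on $[0,r]$, and $a$ and $b$ are independent. Let $\mathcal{X}\subset\mathbb{R}^d$ be compact, let $g$ be a real-valued function that is continuous (hence bounded) on $\mathcal{X}$, and let $\epsilon>0$. Then there exist an integer $N\ge 0$, coefficients $\alpha_1,\dots,\alpha_N\in\mathbb{R}$ and points $x_1,\dots,x_N\in\mathbb{R}^d$ such that the function $$f_N(q)=\sum_{n=1}^N\alpha_n\,\mathcal{K}(x_n,q)$$ satisfies $\sup_{q\in\mathcal{X}}|f_N(q)-g(q)|\le\epsilon$. -/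

import Mathlib

open MeasureTheory ProbabilityTheory

noncomputable section

namespace LSH

/-- The L2 (2-stable) locality sensitive hash function with projection vector `a`, offset `b` and
bucket width `r`: `h(x) = ⌊(⟨a, x⟩ + b) / r⌋`. -/
def l2Hash {d : ℕ} (r : ℝ) (a : EuclideanSpace ℝ (Fin d)) (b : ℝ)
    (x : EuclideanSpace ℝ (Fin d)) : ℤ :=
  ⌊(inner ℝ a x + b) / r⌋

/-- The law of the random parameters `(a, b)` of the L2 hash function: `a` has independent standard
normal coordinates, `b` is uniform on `[0, r]`, and `a` and `b` are independent. -/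
def l2HashLaw (d : ℕ) (r : ℝ) : Measure (EuclideanSpace ℝ (Fin d) × ℝ) :=
  (stdGaussian (EuclideanSpace ℝ (Fin d))).prod (cond volume (Set.Icc (0 : ℝ) r))

/-- The L2 LSH kernel: the collision probability `Pr[h(x) = h(y)]` of a random L2 hash function. -/
def l2Kernel {d : ℕ} (r : ℝ) (x y : EuclideanSpace ℝ (Fin d)) : ℝ :=
  (l2HashLaw d r).real {p | l2Hash r p.1 p.2 x = l2Hash r p.1 p.2 y}

end LSH

end

noncomputable section

/-! For fixed `a`, averaging over `b` gives collision probability `tent r ⟪a, x - y⟫`. The Fourier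
transform of the tent, `r * sinc (π r t) ^ 2`, is nonnegative and integrable, so inversion writes
`K(x, y)` as an average of `cos (⟪ω, x⟫ - ⟪ω, y⟫)` over frequencies `ω = 2πta` with nonnegative
weight (`l2Kernel_eq_integral_cos`).

Suppose `L` in the dual of `C(X, ℝ)` kills every `K(x, ·)` with `x ∈ X`. Applying `L` in both
variables makes the weighted integral of `L(cos ⟪ω, ·⟫)² + L(sin ⟪ω, ·⟫)²` vanish
(`integral_sq_eq_zero`). By positivity and continuity `L` kills every `cos ⟪ω, ·⟫` and `sin ⟪ω, ·⟫`;
these span a dense subspace by Stone–Weierstrass, so `L = 0`. Hahn–Banach then gives density of the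
span of the `K(x, ·)`, even with centres in `X`. -/

instance stdGaussian.isOpenPosMeasure {E : Type*} [NormedAddCommGroup E] [InnerProductSpace ℝ E]
    [FiniteDimensional ℝ E] [MeasurableSpace E] [BorelSpace E] :
    (stdGaussian E).IsOpenPosMeasure := by
  have : (gaussianReal 0 1).IsOpenPosMeasure :=
    (gaussianReal_absolutelyContinuous' 0 one_ne_zero).isOpenPosMeasure
  refine Continuous.isOpenPosMeasure_map (by fun_prop) fun x ↦ ?_
  exact ⟨fun i ↦ (stdOrthonormalBasis ℝ E).repr x i, (stdOrthonormalBasis ℝ E).sum_repr x⟩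

/-! ### Fourier inversion for the tent function -/

theorem sinc_sq_le (x : ℝ) : Real.sinc x ^ 2 ≤ 2 * (1 + x ^ 2)⁻¹ := by
  have h1 : Real.sinc x ^ 2 ≤ 1 := by
    rw [sq_le_one_iff_abs_le_one]; exact Real.abs_sinc_le_one x
  have h2 : x ^ 2 * Real.sinc x ^ 2 ≤ 1 := by
    rcases eq_or_ne x 0 with rfl | hx
    · simp
    · rw [Real.sinc_of_ne_zero hx, div_pow, mul_div_cancel₀ _ (pow_ne_zero 2 hx)]
      exact Real.sin_sq_le_one x
  rw [← div_eq_mul_inv, le_div_iff₀ (by positivity)]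
  linarith

theorem integrable_sinc_sq : Integrable fun x : ℝ ↦ Real.sinc x ^ 2 := by
  refine (integrable_inv_one_add_sq.const_mul 2).mono'
    (Real.continuous_sinc.pow 2).aestronglyMeasurable (.of_forall fun x ↦ ?_)
  rw [Real.norm_of_nonneg (by positivity)]
  exact sinc_sq_le x

/-- The tent function `s ↦ max (1 - |s| / r) 0`. -/
def tent (r s : ℝ) : ℝ := max (1 - |s| / r) 0

theorem continuous_tent (r : ℝ) : Continuous (tent r) := by unfold tent; fun_prop

theorem tent_neg (r s : ℝ) : tent r (-s) = tent r s := by simp [tent]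

theorem tent_of_nonneg_of_le {r s : ℝ} (hs : 0 ≤ s) (hsr : s ≤ r) : tent r s = 1 - s / r := by
  rw [tent, abs_of_nonneg hs, max_eq_left]
  exact sub_nonneg.2 (div_le_one_of_le₀ hsr (hs.trans hsr))

theorem tent_of_le_abs {r s : ℝ} (hr : 0 < r) (hs : r ≤ |s|) : tent r s = 0 :=
  max_eq_right (sub_nonpos.2 ((one_le_div hr).2 hs))

theorem integral_one_sub_div_mul_cos {r : ℝ} (hr : 0 < r) (t : ℝ) :
    ∫ s in (0 : ℝ)..r, (1 - s / r) * (2 * Real.cos (2 * Real.pi * s * t)) =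
      r * Real.sinc (Real.pi * r * t) ^ 2 := by
  rcases eq_or_ne t 0 with rfl | ht
  · have : ∀ s ∈ Set.uIcc 0 r, HasDerivAt (fun s : ℝ ↦ 2 * s - s ^ 2 / r)
        ((1 - s / r) * (2 * Real.cos (2 * Real.pi * s * 0))) s := fun s _ ↦ by
      refine (((hasDerivAt_id s).const_mul 2).sub
        ((hasDerivAt_pow 2 s).div_const r)).congr_deriv ?_
      simp; ring
    rw [intervalIntegral.integral_eq_sub_of_hasDerivAt this
      (Continuous.intervalIntegrable (by fun_prop) _ _)]
    simp; field_simp; ring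
  · have hw : 2 * Real.pi * t ≠ 0 := by positivity
    -- This antiderivative comes from one integration by parts.
    have : ∀ s ∈ Set.uIcc 0 r, HasDerivAt (fun s : ℝ ↦
        2 * ((1 - s / r) * (Real.sin (2 * Real.pi * t * s) / (2 * Real.pi * t)) -
          Real.cos (2 * Real.pi * t * s) / (r * (2 * Real.pi * t) ^ 2)))
        ((1 - s / r) * (2 * Real.cos (2 * Real.pi * s * t))) s := fun s _ ↦ by
      have h0 : HasDerivAt (fun s : ℝ ↦ 2 * Real.pi * t * s) (2 * Real.pi * t) s := by
        simpa using (hasDerivAt_id s).const_mul (2 * Real.pi * t)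
      have h1 : HasDerivAt (fun s : ℝ ↦ 1 - s / r) (-(1 / r)) s :=
        ((hasDerivAt_id s).div_const r).const_sub 1
      refine (((h1.mul (h0.sin.div_const (2 * Real.pi * t))).sub
        (h0.cos.div_const (r * (2 * Real.pi * t) ^ 2))).const_mul 2).congr_deriv ?_
      rw [show 2 * Real.pi * s * t = 2 * Real.pi * t * s by ring]
      field_simp
      ring
    rw [intervalIntegral.integral_eq_sub_of_hasDerivAt this
      (Continuous.intervalIntegrable (by fun_prop) _ _), Real.sinc_of_ne_zero (by positivity),
      div_pow, Real.sin_sq_eq_half_sub]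
    rw [show 2 * (Real.pi * r * t) = 2 * Real.pi * t * r by ring, div_self hr.ne']
    simp
    field_simp
    ring

open FourierTransform in
theorem fourier_tent {r : ℝ} (hr : 0 < r) (t : ℝ) :
    𝓕 (fun s ↦ (tent r s : ℂ)) t = (r * Real.sinc (Real.pi * r * t) ^ 2 : ℝ) := by
  rw [Real.fourier_real_eq_integral_exp_smul, ← integral_one_sub_div_mul_cos hr t,
    ← intervalIntegral.integral_ofReal]
  set F : ℝ → ℂ := fun s ↦ Complex.exp (↑(-2 * Real.pi * s * t) * Complex.I) • (tent r s : ℂ)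
    with hF
  have hFc : Continuous F := by
    have := continuous_tent r
    fun_prop
  have hsupp : Function.support F ⊆ Set.Ioc (-r) r := fun s hs ↦ by
    by_contra h
    apply hs
    have : r ≤ |s| := by
      rw [Set.mem_Ioc, not_and_or, not_lt, not_le] at h
      rcases h with h | h
      · exact le_abs.2 (.inr (by linarith))
      · exact le_abs.2 (.inl h.le)
    simp [hF, tent_of_le_abs hr this]
  rw [← intervalIntegral.integral_eq_integral_of_support_subset hsupp,
    ← intervalIntegral.integral_add_adjacent_intervals (b := 0) (hFc.intervalIntegrable _ _)
      (hFc.intervalIntegrable _ _)]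
  -- Folding `[-r, 0]` onto `[0, r]` pairs conjugate exponentials into `2 cos`.
  have := intervalIntegral.integral_comp_neg (a := 0) (b := r) F
  rw [neg_zero] at this
  have hFn : Continuous fun s ↦ F (-s) := hFc.comp continuous_neg
  rw [← this, ← intervalIntegral.integral_add (hFn.intervalIntegrable _ _)
    (hFc.intervalIntegrable _ _)]
  refine intervalIntegral.integral_congr fun s hs ↦ ?_
  rw [Set.uIcc_of_le hr.le] at hs
  simp only [hF, tent_neg, tent_of_nonneg_of_le hs.1 hs.2, smul_eq_mul, ← add_mul]
  rw [mul_comm]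
  push_cast
  rw [Complex.two_cos]
  congr 3 <;> ring_nf

theorem integrable_tent {r : ℝ} (hr : 0 < r) : Integrable (tent r) := by
  refine (continuous_tent r).integrable_of_hasCompactSupport ?_
  refine HasCompactSupport.intro (isCompact_Icc (a := -r) (b := r)) fun s hs ↦ ?_
  refine tent_of_le_abs hr (le_of_lt ?_)
  rwa [← not_le, abs_le]

theorem integrable_mul_sinc_sq {r : ℝ} (hr : 0 < r) :
    Integrable fun t : ℝ ↦ r * Real.sinc (Real.pi * r * t) ^ 2 :=
  (integrable_sinc_sq.comp_mul_left' (by positivity)).const_mul r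

open FourierTransform in
theorem tent_eq_integral {r : ℝ} (hr : 0 < r) (s : ℝ) :
    tent r s = ∫ t, r * Real.sinc (Real.pi * r * t) ^ 2 * Real.cos (2 * Real.pi * t * s) := by
  have hF : 𝓕 (fun s ↦ (tent r s : ℂ)) =
      fun t ↦ ((r * Real.sinc (Real.pi * r * t) ^ 2 : ℝ) : ℂ) := funext (fourier_tent hr)
  have h := congrFun (Continuous.fourierInv_fourier_eq (f := fun s ↦ (tent r s : ℂ))
    (Complex.continuous_ofReal.comp (continuous_tent r)) (integrable_tent hr).ofReal
    (by rw [hF]; exact (integrable_mul_sinc_sq hr).ofReal)) s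
  rw [hF, Real.fourierInv_eq'] at h
  have h2 := congrArg Complex.re h
  rw [Complex.ofReal_re] at h2
  rw [← h2, ← RCLike.re_eq_complex_re, ← integral_re]
  · refine integral_congr_ae (.of_forall fun t ↦ ?_)
    simp only [smul_eq_mul, RCLike.re_eq_complex_re, Complex.re_mul_ofReal]
    rw [Complex.exp_ofReal_mul_I_re, mul_comm]
    congr 2
    simp; ring
  · refine (integrable_mul_sinc_sq hr).ofReal.bdd_mul (c := 1) (by fun_prop) (.of_forall fun t ↦ ?_)
    rw [Complex.norm_exp_ofReal_mul_I]

/-! ### Collision probability over a random offset -/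

theorem measurableSet_floor_eq (r u v : ℝ) :
    MeasurableSet {b : ℝ | ⌊(u + b) / r⌋ = ⌊(v + b) / r⌋} :=
  measurableSet_eq_fun (by fun_prop) (by fun_prop)

/-- The collision set is `r`-periodic in `b`, so the window may start at `-u`. There the first floor
is `0`, and collision means `b < r - v`. If `v - u ≥ r` the interval is empty, matching the
truncation in `tent`. -/
theorem volume_real_floor_eq {r u v : ℝ} (hr : 0 < r) (huv : u ≤ v) :
    volume.real (Set.Icc 0 r ∩ {b : ℝ | ⌊(u + b) / r⌋ = ⌊(v + b) / r⌋}) = r * tent r (u - v) := by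
  set S := {b : ℝ | ⌊(u + b) / r⌋ = ⌊(v + b) / r⌋} with hS
  have hSm : MeasurableSet S := measurableSet_floor_eq r u v
  have hper : Function.Periodic (S.indicator (1 : ℝ → ℝ)) r := fun b ↦ by
    have hmem : b + r ∈ S ↔ b ∈ S := by
      simp only [hS, Set.mem_ofPred_eq, ← add_assoc, add_div _ r, div_self hr.ne', Int.floor_add_one,
        add_left_inj]
    simp only [Set.indicator_apply, hmem, Pi.one_apply]
  have key (t : ℝ) : ∫ b in t..t + r, S.indicator (1 : ℝ → ℝ) b =
      volume.real (Set.Ico t (t + r) ∩ S) := by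
    rw [intervalIntegral.integral_of_le (by linarith), ← integral_Icc_eq_integral_Ioc,
      integral_Icc_eq_integral_Ico, integral_indicator_one hSm, measureReal_restrict_apply hSm,
      Set.inter_comm]
  have hIco : Set.Ico (-u) (-u + r) ∩ S = Set.Ico (-u) (r - v) := by
    ext b
    simp only [Set.mem_inter_iff, Set.mem_Ico, hS, Set.mem_ofPred_eq]
    constructor
    · rintro ⟨⟨h1, h2⟩, h3⟩
      have h0 : ⌊(u + b) / r⌋ = 0 := by
        rw [Int.floor_eq_zero_iff]
        exact ⟨div_nonneg (by linarith) hr.le, (div_lt_one hr).2 (by linarith)⟩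
      rw [h0, eq_comm, Int.floor_eq_zero_iff] at h3
      have := (div_lt_one hr).1 h3.2
      exact ⟨h1, by linarith⟩
    · rintro ⟨h1, h2⟩
      refine ⟨⟨h1, by linarith⟩, ?_⟩
      rw [Int.floor_eq_zero_iff.2 ⟨div_nonneg (by linarith) hr.le, (div_lt_one hr).2 (by linarith)⟩,
        Int.floor_eq_zero_iff.2 ⟨div_nonneg (by linarith) hr.le, (div_lt_one hr).2 (by linarith)⟩]
  have hIcc : volume.real (Set.Icc 0 r ∩ S) = volume.real (Set.Ico 0 (0 + r) ∩ S) := by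
    rw [zero_add]
    exact measureReal_congr (Ico_ae_eq_Icc.symm.inter (ae_eq_refl _))
  rw [hIcc, ← key, hper.intervalIntegral_add_eq 0 (-u), key, hIco, Real.volume_real_Ico, tent,
    abs_of_nonpos (by linarith), mul_max_of_nonneg _ _ hr.le, mul_zero]
  congr 1
  field_simp
  ring

theorem cond_real_floor_eq {r : ℝ} (hr : 0 < r) (u v : ℝ) :
    (cond volume (Set.Icc (0 : ℝ) r)).real {b : ℝ | ⌊(u + b) / r⌋ = ⌊(v + b) / r⌋} =
      tent r (u - v) := by
  wlog huv : u ≤ v generalizing u v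
  · rw [← tent_neg, neg_sub, ← this v u (by linarith)]
    simp only [eq_comm]
  rw [measureReal_def, cond_apply measurableSet_Icc, ENNReal.toReal_mul, ← measureReal_def,
    volume_real_floor_eq hr huv, Real.volume_Icc, ENNReal.toReal_inv,
    ENNReal.toReal_ofReal (by linarith), sub_zero, inv_mul_cancel_left₀ hr.ne']

/-! ### Spectral representation of the kernel -/

namespace LSH

variable {d : ℕ} {r : ℝ}

theorem measurable_l2Hash (x : EuclideanSpace ℝ (Fin d)) :
    Measurable fun p : EuclideanSpace ℝ (Fin d) × ℝ ↦ l2Hash r p.1 p.2 x :=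
  Int.measurable_floor.comp <|
    (((continuous_fst.inner continuous_const).add continuous_snd).div_const r).measurable

theorem l2Kernel_eq_integral_tent (hr : 0 < r) (x y : EuclideanSpace ℝ (Fin d)) :
    l2Kernel r x y = ∫ a, tent r (inner ℝ a (x - y)) ∂stdGaussian (EuclideanSpace ℝ (Fin d)) := by
  have : IsProbabilityMeasure (cond volume (Set.Icc (0 : ℝ) r)) :=
    cond_isProbabilityMeasure_of_finite (by simp [hr]) (by simp)
  have hm : MeasurableSet {p : EuclideanSpace ℝ (Fin d) × ℝ |
      l2Hash r p.1 p.2 x = l2Hash r p.1 p.2 y} :=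
    measurableSet_eq_fun (measurable_l2Hash x) (measurable_l2Hash y)
  rw [l2Kernel, l2HashLaw, measureReal_def, Measure.prod_apply hm, ← integral_toReal
    (measurable_measure_prodMk_left hm).aemeasurable (.of_forall fun _ ↦ measure_lt_top _ _)]
  refine integral_congr_ae (.of_forall fun a ↦ ?_)
  simp only [inner_sub_right]
  rw [← cond_real_floor_eq hr]
  rfl

theorem l2Kernel_eq_integral_cos (hr : 0 < r) (x y : EuclideanSpace ℝ (Fin d)) :
    l2Kernel r x y = ∫ p : EuclideanSpace ℝ (Fin d) × ℝ,
      r * Real.sinc (Real.pi * r * p.2) ^ 2 *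
        Real.cos (inner ℝ ((2 * Real.pi * p.2) • p.1) x - inner ℝ ((2 * Real.pi * p.2) • p.1) y)
      ∂(stdGaussian (EuclideanSpace ℝ (Fin d))).prod volume := by
  rw [l2Kernel_eq_integral_tent hr, integral_prod]
  · refine integral_congr_ae (.of_forall fun a ↦ ?_)
    simp only [tent_eq_integral hr, real_inner_smul_left, ← mul_sub, ← inner_sub_right]
  · refine ((integrable_mul_sinc_sq hr).comp_snd _).mul_bdd (c := 1)
      (Continuous.aestronglyMeasurable (by fun_prop)) (.of_forall fun p ↦ ?_)
    exact Real.abs_cos_le_one _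

end LSH

theorem exists_dual_ne_zero_of_notMem_topologicalClosure {E : Type*} [NormedAddCommGroup E] [NormedSpace ℝ E]
    {p : Submodule ℝ E} {x : E} (hx : x ∉ p.topologicalClosure) :
    ∃ L : StrongDual ℝ E, (∀ y ∈ p, L y = 0) ∧ L x ≠ 0 := by
  obtain ⟨L, u, hu, hL⟩ := geometric_hahn_banach_point_closed
    p.topologicalClosure.convex p.isClosed_topologicalClosure hx
  have hu0 : u < 0 := by simpa using hL 0 (zero_mem _)
  refine ⟨L, fun y hy ↦ ?_, (hu.trans hu0).ne⟩
  by_contra h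
  -- This multiple of `y` has `L`-value exactly `u`, against strict separation.
  have := hL ((u / L y) • y) (Submodule.smul_mem _ _ (p.le_topologicalClosure hy))
  rw [map_smul, smul_eq_mul, div_mul_cancel₀ _ h] at this
  exact this.false

/-! ### Density of trigonometric polynomials -/

section Trigonometric

variable {E : Type*} [NormedAddCommGroup E] [InnerProductSpace ℝ E] (X : Set E)

/-- The functions `q ↦ cos ⟪ω, q⟫` on `X`, depending continuously on `ω`. -/
def cosInner : C(E, C(X, ℝ)) :=
  ContinuousMap.curry ⟨fun p : E × X ↦ Real.cos (inner ℝ p.1 (p.2 : E)), by fun_prop⟩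

/-- The functions `q ↦ sin ⟪ω, q⟫` on `X`, depending continuously on `ω`. -/
def sinInner : C(E, C(X, ℝ)) :=
  ContinuousMap.curry ⟨fun p : E × X ↦ Real.sin (inner ℝ p.1 (p.2 : E)), by fun_prop⟩

variable {X}

@[simp] theorem cosInner_apply (ω : E) (q : X) : cosInner X ω q = Real.cos (inner ℝ ω (q : E)) :=
  rfl

@[simp] theorem sinInner_apply (ω : E) (q : X) : sinInner X ω q = Real.sin (inner ℝ ω (q : E)) :=
  rfl

variable (X) in
/-- The real trigonometric polynomials on `X`. -/
def trigPolynomials : Submodule ℝ C(X, ℝ) :=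
  Submodule.span ℝ (Set.range (cosInner X) ∪ Set.range (sinInner X))

theorem cosInner_mem (ω : E) : cosInner X ω ∈ trigPolynomials X :=
  Submodule.subset_span (.inl ⟨ω, rfl⟩)

theorem sinInner_mem (ω : E) : sinInner X ω ∈ trigPolynomials X :=
  Submodule.subset_span (.inr ⟨ω, rfl⟩)

theorem one_mem_trigPolynomials : (1 : C(X, ℝ)) ∈ trigPolynomials X := by
  convert cosInner_mem (X := X) 0
  ext q
  simp

theorem mul_mem_trigPolynomials {f g : C(X, ℝ)} (hf : f ∈ trigPolynomials X)
    (hg : g ∈ trigPolynomials X) : f * g ∈ trigPolynomials X := by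
  have hmul := Submodule.mul_mem_mul hf hg
  rw [trigPolynomials, Submodule.span_mul_span] at hmul
  refine Submodule.span_le.2 ?_ hmul
  rintro _ ⟨_, ⟨ω, rfl⟩ | ⟨ω, rfl⟩, _, ⟨η, rfl⟩ | ⟨η, rfl⟩, rfl⟩
  · refine Set.mem_of_eq_of_mem ?_ <| Submodule.smul_mem _ (2⁻¹ : ℝ)
      (add_mem (cosInner_mem (X := X) (ω - η)) (cosInner_mem (ω + η)))
    ext q
    simp [inner_sub_left, inner_add_left, Real.cos_add, Real.cos_sub]; ring
  · refine Set.mem_of_eq_of_mem ?_ <| Submodule.smul_mem _ (2⁻¹ : ℝ)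
      (sub_mem (sinInner_mem (X := X) (ω + η)) (sinInner_mem (ω - η)))
    ext q
    simp [inner_sub_left, inner_add_left, Real.sin_add, Real.sin_sub]; ring
  · refine Set.mem_of_eq_of_mem ?_ <| Submodule.smul_mem _ (2⁻¹ : ℝ)
      (add_mem (sinInner_mem (X := X) (ω - η)) (sinInner_mem (ω + η)))
    ext q
    simp [inner_sub_left, inner_add_left, Real.sin_add, Real.sin_sub]; ring
  · refine Set.mem_of_eq_of_mem ?_ <| Submodule.smul_mem _ (2⁻¹ : ℝ)
      (sub_mem (cosInner_mem (X := X) (ω - η)) (cosInner_mem (ω + η)))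
    ext q
    simp [inner_sub_left, inner_add_left, Real.cos_add, Real.cos_sub]; ring

theorem topologicalClosure_trigPolynomials [CompactSpace X] :
    (trigPolynomials X).topologicalClosure = ⊤ := by
  set A : Subalgebra ℝ C(X, ℝ) := (trigPolynomials X).toSubalgebra one_mem_trigPolynomials
    fun _ _ ↦ mul_mem_trigPolynomials
  have hsep : A.SeparatesPoints := fun x y hxy ↦ by
    by_contra h
    -- Scaled so that `⟪ω, x - y⟫ = 1`; equal sines and cosines at `x` and `y` would then force `cos
    -- 1 = 1`.
    set ω : E := (‖(x - y : E)‖ ^ 2)⁻¹ • (x - y : E)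
    have hcos : Real.cos (inner ℝ ω (x : E)) = Real.cos (inner ℝ ω (y : E)) := by
      by_contra hne
      exact h ⟨_, ⟨cosInner X ω, cosInner_mem ω, rfl⟩, hne⟩
    have hsin : Real.sin (inner ℝ ω (x : E)) = Real.sin (inner ℝ ω (y : E)) := by
      by_contra hne
      exact h ⟨_, ⟨sinInner X ω, sinInner_mem ω, rfl⟩, hne⟩
    have hω : inner ℝ ω (x : E) - inner ℝ ω (y : E) = 1 := by
      rw [← inner_sub_right, real_inner_smul_left, real_inner_self_eq_norm_sq, inv_mul_cancel₀]
      simpa [sub_eq_zero, Subtype.ext_iff] using hxy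
    have h1 : Real.cos 1 = 1 := by
      nth_rw 1 [← hω]
      rw [Real.cos_sub, hcos, hsin, ← sq, ← sq, Real.cos_sq_add_sin_sq]
    linarith [Real.cos_one_le]
  have := ContinuousMap.subalgebra_topologicalClosure_eq_top_of_separatesPoints A hsep
  rw [← Submodule.dense_iff_topologicalClosure_eq_top]
  have hd : Dense (A : Set C(X, ℝ)) := by
    rw [dense_iff_closure_eq, ← Subalgebra.topologicalClosure_coe, this, Algebra.coe_top]
  exact hd

end Trigonometric

/-! ### Functionals annihilating the kernel functions -/

namespace LSH

variable {d : ℕ} {r : ℝ} {X : Set (EuclideanSpace ℝ (Fin d))}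

/-- The Fourier transform of the tent function of half-width `r`. -/
def spectralDensity (r t : ℝ) : ℝ := r * Real.sinc (Real.pi * r * t) ^ 2

/-- The frequency `2πta` attached to `p = (a, t)`. -/
def frequency (p : EuclideanSpace ℝ (Fin d) × ℝ) : EuclideanSpace ℝ (Fin d) :=
  (2 * Real.pi * p.2) • p.1

variable (X) in
/-- The spectral component of `q ↦ K(x, q)` at the parameter `p = (a, t)`. -/
def kernelIntegrand (r : ℝ) (x : EuclideanSpace ℝ (Fin d)) (p : EuclideanSpace ℝ (Fin d) × ℝ) :
    C(X, ℝ) :=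
  spectralDensity r p.2 • (Real.cos (inner ℝ (frequency p) x) • cosInner X (frequency p) +
    Real.sin (inner ℝ (frequency p) x) • sinInner X (frequency p))

theorem continuous_spectralDensity : Continuous (spectralDensity r) := by
  unfold spectralDensity
  have := Real.continuous_sinc
  fun_prop

theorem continuous_frequency : Continuous (frequency (d := d)) := by
  unfold frequency
  fun_prop

theorem norm_cosInner_le [CompactSpace X] (ω : EuclideanSpace ℝ (Fin d)) : ‖cosInner X ω‖ ≤ 1 :=
  (ContinuousMap.norm_le _ zero_le_one).2 fun _ ↦ Real.abs_cos_le_one _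

theorem norm_sinInner_le [CompactSpace X] (ω : EuclideanSpace ℝ (Fin d)) : ‖sinInner X ω‖ ≤ 1 :=
  (ContinuousMap.norm_le _ zero_le_one).2 fun _ ↦ Real.abs_sin_le_one _

theorem integrable_spectralDensity_smul (hr : 0 < r) {F : Type*} [NormedAddCommGroup F]
    [NormedSpace ℝ F] {f : EuclideanSpace ℝ (Fin d) × ℝ → F} (hf : Continuous f) {c : ℝ}
    (hc : ∀ p, ‖f p‖ ≤ c) :
    Integrable (fun p ↦ spectralDensity r p.2 • f p)
      ((stdGaussian (EuclideanSpace ℝ (Fin d))).prod volume) :=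
  Integrable.smul_bdd ((integrable_mul_sinc_sq hr).comp_snd _) c hf.aestronglyMeasurable
    (.of_forall hc)

theorem integrable_kernelIntegrand (hr : 0 < r) [CompactSpace X] (x : EuclideanSpace ℝ (Fin d)) :
    Integrable (kernelIntegrand X r x)
      ((stdGaussian (EuclideanSpace ℝ (Fin d))).prod volume) := by
  have := continuous_frequency (d := d)
  refine integrable_spectralDensity_smul (c := 1 * 1 + 1 * 1) hr (by fun_prop) fun p ↦ ?_
  refine (norm_add_le _ _).trans ?_
  rw [norm_smul, norm_smul]
  gcongr
  exacts [Real.abs_cos_le_one _, norm_cosInner_le _, Real.abs_sin_le_one _, norm_sinInner_le _]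

variable (X) in
/-- The function `K(x, ·)`, as a continuous function on `X`. -/
def kernelMap [CompactSpace X] (r : ℝ) (x : EuclideanSpace ℝ (Fin d)) : C(X, ℝ) :=
  ∫ p, kernelIntegrand X r x p ∂(stdGaussian (EuclideanSpace ℝ (Fin d))).prod volume

theorem kernelMap_apply [CompactSpace X] (hr : 0 < r) (x : EuclideanSpace ℝ (Fin d)) (q : X) :
    kernelMap X r x q = l2Kernel r x q := by
  rw [l2Kernel_eq_integral_cos hr]
  have := (ContinuousMap.evalCLM ℝ q : C(X, ℝ) →L[ℝ] ℝ).integral_comp_comm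
    (integrable_kernelIntegrand (X := X) hr x)
  refine this.symm.trans (integral_congr_ae (.of_forall fun p ↦ ?_))
  simp [kernelIntegrand, Real.cos_sub, spectralDensity, frequency, mul_add]

theorem integral_sq_eq_zero [CompactSpace X] (hr : 0 < r) {L : StrongDual ℝ C(X, ℝ)}
    (hL : ∀ x : X, L (kernelMap X r x) = 0) :
    ∫ p, spectralDensity r p.2 * (L (cosInner X (frequency p)) ^ 2 +
      L (sinInner X (frequency p)) ^ 2)
      ∂(stdGaussian (EuclideanSpace ℝ (Fin d))).prod volume = 0 := by
  have hfr := continuous_frequency (d := d)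
  set Φ : EuclideanSpace ℝ (Fin d) × ℝ → C(X, ℝ) := fun p ↦ spectralDensity r p.2 •
    (L (cosInner X (frequency p)) • cosInner X (frequency p) +
      L (sinInner X (frequency p)) • sinInner X (frequency p)) with hΦ
  have hΦi : Integrable Φ ((stdGaussian (EuclideanSpace ℝ (Fin d))).prod volume) := by
    refine integrable_spectralDensity_smul (c := ‖L‖ * 1 * 1 + ‖L‖ * 1 * 1) hr (by fun_prop)
      fun p ↦ ?_
    refine (norm_add_le _ _).trans ?_
    rw [norm_smul, norm_smul]
    gcongr
    exacts [L.le_of_opNorm_le_of_le le_rfl (norm_cosInner_le _), norm_cosInner_le _,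
      L.le_of_opNorm_le_of_le le_rfl (norm_sinInner_le _), norm_sinInner_le _]
  have hΦ0 : ∫ p, Φ p ∂(stdGaussian (EuclideanSpace ℝ (Fin d))).prod volume = 0 := by
    ext x
    have h1 := (ContinuousMap.evalCLM ℝ x : C(X, ℝ) →L[ℝ] ℝ).integral_comp_comm hΦi
    have h2 := L.integral_comp_comm (integrable_kernelIntegrand (X := X) hr x)
    -- The integrand of `K(x, ·)` is symmetric in its two variables, so the value at `x` of the
    -- integral of `Φ` is `L (kernelMap X r x)`.
    refine h1.symm.trans (.trans ?_ (h2.trans (hL x)))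
    refine integral_congr_ae (.of_forall fun p ↦ ?_)
    simp [hΦ, kernelIntegrand, mul_comm]
  have h := L.integral_comp_comm hΦi
  rw [hΦ0, map_zero] at h
  rw [← h]
  refine integral_congr_ae (.of_forall fun p ↦ ?_)
  simp [hΦ, sq, mul_add]

theorem apply_cosInner_sinInner_eq_zero [CompactSpace X] (hr : 0 < r) {L : StrongDual ℝ C(X, ℝ)}
    (hL : ∀ x : X, L (kernelMap X r x) = 0) (ω : EuclideanSpace ℝ (Fin d)) :
    L (cosInner X ω) = 0 ∧ L (sinInner X ω) = 0 := by
  have hfr := continuous_frequency (d := d)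
  have hsd := continuous_spectralDensity (r := r)
  set f : EuclideanSpace ℝ (Fin d) × ℝ → ℝ := fun p ↦ L (cosInner X (frequency p)) ^ 2 +
    L (sinInner X (frequency p)) ^ 2 with hf
  have hfc : Continuous f := by fun_prop
  have hfi : Integrable (fun p ↦ spectralDensity r p.2 * f p)
      ((stdGaussian (EuclideanSpace ℝ (Fin d))).prod volume) := by
    refine integrable_spectralDensity_smul (c := (‖L‖ * 1) ^ 2 + (‖L‖ * 1) ^ 2) hr hfc fun p ↦ ?_
    rw [Real.norm_of_nonneg (by positivity)]
    refine add_le_add (sq_le_sq' ?_ ?_) (sq_le_sq' ?_ ?_)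
    · exact (abs_le.1 (L.le_of_opNorm_le_of_le le_rfl (norm_cosInner_le _))).1
    · exact (abs_le.1 (L.le_of_opNorm_le_of_le le_rfl (norm_cosInner_le _))).2
    · exact (abs_le.1 (L.le_of_opNorm_le_of_le le_rfl (norm_sinInner_le _))).1
    · exact (abs_le.1 (L.le_of_opNorm_le_of_le le_rfl (norm_sinInner_le _))).2
  have hnn : 0 ≤ fun p : EuclideanSpace ℝ (Fin d) × ℝ ↦ spectralDensity r p.2 * f p := fun p ↦ by
    simp only [spectralDensity, hf, Pi.zero_apply]
    positivity
  have hae := (integral_eq_zero_iff_of_nonneg hnn hfi).1 (integral_sq_eq_zero hr hL)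
  -- The product measure charges every nonempty open set, so the continuous integrand vanishes
  -- everywhere. At `t = 1 / (2r)` the density is `4r / π² ≠ 0`, and `a = (r / π) • ω` gives
  -- frequency `ω`.
  have h0 := congrFun (Measure.eq_of_ae_eq hae (by fun_prop) continuous_zero)
    (((r / Real.pi) • ω), 1 / (2 * r))
  have hpi := Real.pi_pos
  have hfreq : frequency (((r / Real.pi) • ω), 1 / (2 * r)) = ω := by
    rw [frequency, smul_smul]
    convert one_smul ℝ ω
    field_simp
  have hd : spectralDensity r (1 / (2 * r)) ≠ 0 := by
    rw [spectralDensity, show Real.pi * r * (1 / (2 * r)) = Real.pi / 2 by field_simp,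
      Real.sinc_of_ne_zero (by positivity), Real.sin_pi_div_two]
    positivity
  have := (mul_eq_zero.1 h0).resolve_left hd
  simp only [hf, hfreq] at this
  constructor <;> nlinarith [sq_nonneg (L (cosInner X ω)), sq_nonneg (L (sinInner X ω))]

theorem topologicalClosure_span_kernelMap [CompactSpace X] (hr : 0 < r) :
    (Submodule.span ℝ (Set.range fun x : X ↦ kernelMap X r x)).topologicalClosure = ⊤ := by
  refine eq_top_iff.2 fun g _ ↦ ?_
  by_contra hg
  obtain ⟨L, hL, hLg⟩ := exists_dual_ne_zero_of_notMem_topologicalClosure hg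
  have h := apply_cosInner_sinInner_eq_zero hr fun x ↦ hL _ (Submodule.subset_span ⟨x, rfl⟩)
  have hker : (trigPolynomials X).topologicalClosure ≤ LinearMap.ker L.toLinearMap := by
    refine Submodule.topologicalClosure_minimal _ (Submodule.span_le.2 ?_) L.isClosed_ker
    rintro _ (⟨ω, rfl⟩ | ⟨ω, rfl⟩)
    exacts [(h ω).1, (h ω).2]
  rw [topologicalClosure_trigPolynomials] at hker
  exact hLg (hker Submodule.mem_top)

end LSH

end

theorem theorem3 (d : ℕ) (r : ℝ) (hr : 0 < r)
    (X : Set (EuclideanSpace ℝ (Fin d))) (hX : IsCompact X)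
    (g : EuclideanSpace ℝ (Fin d) → ℝ) (hg : ContinuousOn g X)
    (ε : ℝ) (hε : 0 < ε) :
    ∃ (N : ℕ) (α : Fin N → ℝ) (x : Fin N → EuclideanSpace ℝ (Fin d)),
      ∀ q ∈ X, |(∑ n, α n * LSH.l2Kernel r (x n) q) - g q| ≤ ε := by
  have : CompactSpace X := isCompact_iff_compactSpace.1 hX
  let G : C(X, ℝ) := ⟨X.domRestrict g, hg.domRestrict⟩
  have hG : G ∈ closure (Submodule.span ℝ (Set.range fun x : X ↦ LSH.kernelMap X r x) :
      Set C(X, ℝ)) := by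
    rw [← Submodule.topologicalClosure_coe, LSH.topologicalClosure_span_kernelMap hr]
    trivial
  obtain ⟨f, hf, hfG⟩ := Metric.mem_closure_iff.1 hG ε hε
  obtain ⟨N, α, y, rfl⟩ := Submodule.mem_span_set'.1 hf
  choose x hx using fun n ↦ (y n).2
  refine ⟨N, α, fun n ↦ x n, fun q hq ↦ ?_⟩
  have hle := (ContinuousMap.dist_apply_le_dist (f := G) ⟨q, hq⟩).trans hfG.le
  rw [dist_comm, Real.dist_eq] at hle
  simpa [G, ← hx, LSH.kernelMap_apply hr] using hle
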